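/- Let $X$ be a non-empty compact Hausdorff space, let $\sigma:X\to X$ be a homeomorphism, and put $\Sigma=(X,\sigma)$. Let $\ell^1(\Sigma)=\{a:\mathbb Z\to C(X): \|a\|=\sum_{n}\|a(n)\|_\infty<\infty\}$ be the associated unital Banach algebra, with multiplication $(ab)(n)=\sum_{k\in\mathbb Z}a(k)\cdot\alpha^k(b(n-k))$, where $\alpha(f)=f\circ\sigma^{-1}$; its elements are written as $a=\sum_n f_n\delta^n$ with $f_n=a(n)\in C(X)$. For a periodic point $x$ of period $p$ and $\lambda\in\mathbb T$, let $\pi_{x,\lambda}$ be the representation of $\ell^1(\Sigma)$ on $\mathbb C^p$ (with standard basis $e_0,\dots,e_{p-1}$), given by $\pi_{x,\lambda}(\sum_n f_n\delta^n)=\sum_n\rho_x(f_n)T_\lambda^n$, where $\rho_x(f)e_j=f(\sigma^jx)e_j$ for $0\le j\le p-1$, $T_\lambda e_j=e_{j+1}$ for $0\le j<p-1$, and $T_\lambda e_{p-1}=\lambda e_0$. If $\overline{\mathfrak o}$ is the closure of the (finite) orbit $\mathfrak o$ of $x$, put $P_{\overline{\mathfrak o},\lambda}=\operatorname{Ker}\pi_{x,\lambda}$.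 For an aperiodic point $x$, let $\pi^1_x$ be the representation of $\ell^1(\Sigma)$ on $\ell^1(\mathbb Z)$ (with standard unit vectors $e_k$, $k\in\mathbb Z$) given by $\pi_x^1(\sum_n f_n\delta^n)=\sum_n M_x(f_n)S^n$, where $M_x(f)e_k=f(\sigma^kx)e_k$ and $Se_k=e_{k+1}$. If $\overline{\mathfrak o}$ is the closure of the orbit of $x$, put $P_{\overline{\mathfrak o}}=\operatorname{Ker}\pi^1_x$. These kernels depend only on $(\overline{\mathfrak o},\lambda)$ and on $\overline{\mathfrak o}$, respectively. A primitive ideal of a complex algebra $A$ is the kernel of an algebraically irreducible representation of $A$ on a complex vector space $E$, i.e. of a homomorphism $\pi:A\to\mathcal L(E)$ into the linear operators on $E$ with $\pi(A)E\neq\{0\}$ for which the only invariant subspaces are $\{0\}$ and $E$. The algebra $A$ is semisimple if the intersection of all its primitive ideals is $\{0\}$. **Theorem.** All $P_{\overline{\mathfrak o},\lambda}$ and $P_{\overline{\mathfrak o}}$ as above are primitive ideals of $\ell^1(\Sigma)$, and $$\bigcap_{\overline{\mathfrak o},\ \lambda\in\mathbb T}P_{\overline{\mathfrak o},\lambda}\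 \cap\ \bigcap_{\overline{\mathfrak o}}P_{\overline{\mathfrak o}}=\{0\},$$ where the first intersection is over all closures $\overline{\mathfrak o}$ of orbits of periodic points and all $\lambda\in\mathbb T$, and the second is over all closures $\overline{\mathfrak o}$ of orbits of aperiodic points. (An intersection over an empty index set is $\ell^1(\Sigma)$.) In particular, the Banach algebra $\ell^1(\Sigma)$ is semisimple. -/

import Mathlib

open scoped ENNReal ContinuousMap
set_option linter.unusedSectionVars false

noncomputable section

namespace DynSys

universe u

/-! ### Algebraically irreducible representations, primitive ideals, semisimplicity -/

section Primitive

variable {A : Type u} [Ring A] [Algebra ℂ A]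

/-- A (not necessarily unital) representation `π` of `A` on a complex vector space `E` is
algebraically irreducible if `π(A)E ≠ {0}` and the only invariant subspaces are `{0}` and `E`. -/
def IsAlgIrreducible {E : Type*} [AddCommGroup E] [Module ℂ E]
    (π : A →ₙₐ[ℂ] Module.End ℂ E) : Prop :=
  (∃ a e, π a e ≠ 0) ∧
    ∀ W : Submodule ℂ E, (∀ a, ∀ e ∈ W, π a e ∈ W) → W = ⊥ ∨ W = ⊤

/-- A primitive ideal is the kernel of an algebraically irreducible representation on a complex
vector space. (Every such representation is a quotient of `A` by a left ideal up to equivalence,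
so it is enough to consider vector spaces in the universe of `A`.) -/
def IsPrimitiveIdeal (P : TwoSidedIdeal A) : Prop :=
  ∃ (E : Type u) (_ : AddCommGroup E) (_ : Module ℂ E) (π : A →ₙₐ[ℂ] Module.End ℂ E),
    IsAlgIrreducible π ∧ P = TwoSidedIdeal.ker π

variable (A) in
/-- The Jacobson radical: the intersection of all primitive ideals. -/
def jacobsonRadical : TwoSidedIdeal A := sInf {P | IsPrimitiveIdeal P}

variable (A) in
/-- `A` is semisimple (in the sense of Banach algebra theory) if its Jacobson radical is zero. -/
def IsSemisimpleAlgebra : Prop := jacobsonRadical A = ⊥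

end Primitive

/-! ### The Banach algebra `ℓ¹(Σ)` of a topological dynamical system `Σ = (X, σ)` -/

variable {X : Type u} [TopologicalSpace X]

/-- `alpha σ n f = f ∘ σ⁻ⁿ`, the action of `n ∈ ℤ` on `C(X)`. -/
def alpha (σ : X ≃ₜ X) (n : ℤ) : C(X, ℂ) →⋆ₐ[ℂ] C(X, ℂ) :=
  ContinuousMap.compStarAlgHom' ℂ ℂ ((σ ^ (-n) : X ≃ₜ X) : C(X, X))

@[simp]
lemma alpha_apply (σ : X ≃ₜ X) (n : ℤ) (f : C(X, ℂ)) (x : X) :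
    alpha σ n f x = f ((σ ^ (-n) : X ≃ₜ X) x) := rfl

lemma alpha_alpha (σ : X ≃ₜ X) (m n : ℤ) (f : C(X, ℂ)) :
    alpha σ m (alpha σ n f) = alpha σ (m + n) f := by
  ext x
  simp only [alpha_apply]
  rw [show (-(m + n) : ℤ) = -n + -m by ring, zpow_add]
  rfl

lemma alpha_zero (σ : X ≃ₜ X) (f : C(X, ℂ)) : alpha σ 0 f = f := by
  ext x
  simp

variable [CompactSpace X]

lemma norm_alpha_le (σ : X ≃ₜ X) (n : ℤ) (f : C(X, ℂ)) : ‖alpha σ n f‖ ≤ ‖f‖ :=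
  (ContinuousMap.norm_le _ (norm_nonneg _)).2 fun _ => f.norm_coe_le_norm _

/-- The Banach space `ℓ¹(ℤ, C(X))` underlying the Banach algebra `ℓ¹(Σ)`. It depends on `σ` only
through its multiplication, defined below. -/
def L1 (_σ : X ≃ₜ X) : Type u := lp (fun _ : ℤ => C(X, ℂ)) 1

namespace L1

variable {σ : X ≃ₜ X}

instance : NormedAddCommGroup (L1 σ) :=
  inferInstanceAs (NormedAddCommGroup (lp (fun _ : ℤ => C(X, ℂ)) 1))
instance : NormedSpace ℂ (L1 σ) :=
  inferInstanceAs (NormedSpace ℂ (lp (fun _ : ℤ => C(X, ℂ)) 1))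
instance : CompleteSpace (L1 σ) :=
  inferInstanceAs (CompleteSpace (lp (fun _ : ℤ => C(X, ℂ)) 1))

/-- The coefficients `a(n) = fₙ ∈ C(X)` of `a = ∑ₙ fₙ δⁿ`. -/
def coeff (a : L1 σ) : ℤ → C(X, ℂ) := a.1

instance : CoeFun (L1 σ) fun _ => ℤ → C(X, ℂ) := ⟨coeff⟩

@[ext]
lemma ext {a b : L1 σ} (h : ∀ n, a n = b n) : a = b := lp.ext (funext h)

@[simp] lemma add_apply (a b : L1 σ) (n : ℤ) : (a + b) n = a n + b n := rfl
@[simp] lemma smul_apply (c : ℂ) (a : L1 σ) (n : ℤ) : (c • a) n = c • a n := rfl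

lemma summable_norm (a : L1 σ) : Summable fun n => ‖a n‖ := by
  have := (lp.memℓp (a : lp (fun _ : ℤ => C(X, ℂ)) 1)).summable (by simp)
  simp only [ENNReal.toReal_one, Real.rpow_one] at this
  exact this

lemma norm_eq (a : L1 σ) : ‖a‖ = ∑' n, ‖a n‖ := by
  have := lp.norm_eq_tsum_rpow (p := 1) (by simp) (a : lp (fun _ : ℤ => C(X, ℂ)) 1)
  simp only [ENNReal.toReal_one, Real.rpow_one, div_one] at this
  exact this

/-- The element `f δⁿ` of `ℓ¹(Σ)`. -/
def single (n : ℤ) (f : C(X, ℂ)) : L1 σ := lp.single (E := fun _ : ℤ => C(X, ℂ)) 1 n f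

lemma single_apply (n : ℤ) (f : C(X, ℂ)) (m : ℤ) :
    (single n f : L1 σ) m = if m = n then f else 0 := by
  have := lp.single_apply (E := fun _ : ℤ => C(X, ℂ)) 1 n f m
  rw [Pi.single_apply] at this
  exact this

lemma clm_ext {F : Type*} [NormedAddCommGroup F] [NormedSpace ℂ F] {S T : L1 σ →L[ℂ] F}
    (h : ∀ n f, S (single n f) = T (single n f)) : S = T :=
  lp.ext_continuousLinearMap (𝕜 := ℂ) (E := fun _ : ℤ => C(X, ℂ)) (p := 1) (by simp)
    fun n => ContinuousLinearMap.ext fun f => h n f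

/-! #### Twisted convolution -/

/-- The `k`-th summand of the `n`-th coefficient of the product. -/
def mulTerm (a b : L1 σ) (n k : ℤ) : C(X, ℂ) := a k * alpha σ k (b (n - k))

lemma norm_mulTerm_le (a b : L1 σ) (n k : ℤ) : ‖mulTerm a b n k‖ ≤ ‖a k‖ * ‖b (n - k)‖ :=
  (norm_mul_le _ _).trans (mul_le_mul_of_nonneg_left (norm_alpha_le _ _ _) (norm_nonneg _))

/-- The bijection `(n, k) ↦ (k, n - k)`. -/
def shear : ℤ × ℤ ≃ ℤ × ℤ where
  toFun q := (q.2, q.1 - q.2)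
  invFun q := (q.1 + q.2, q.1)
  left_inv q := by simp
  right_inv q := by simp

lemma hasSum_prod_norm (a b : L1 σ) :
    HasSum (fun q : ℤ × ℤ => ‖a q.2‖ * ‖b (q.1 - q.2)‖) (‖a‖ * ‖b‖) := by
  have h := Summable.mul_of_nonneg a.summable_norm b.summable_norm
    (fun _ => norm_nonneg _) (fun _ => norm_nonneg _)
  have h2 := (a.summable_norm.hasSum.mul b.summable_norm.hasSum h)
  rw [← norm_eq, ← norm_eq] at h2
  exact (shear.hasSum_iff (f := fun q : ℤ × ℤ => ‖a q.1‖ * ‖b q.2‖)).2 h2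

lemma summable_prod_norm_mulTerm (a b : L1 σ) :
    Summable fun q : ℤ × ℤ => ‖mulTerm a b q.1 q.2‖ :=
  Summable.of_nonneg_of_le (fun _ => norm_nonneg _) (fun q => norm_mulTerm_le a b q.1 q.2)
    (hasSum_prod_norm a b).summable

lemma summable_norm_mulTerm (a b : L1 σ) (n : ℤ) : Summable fun k => ‖mulTerm a b n k‖ :=
  (summable_prod_norm_mulTerm a b).prod_factor n

lemma summable_mulTerm (a b : L1 σ) (n : ℤ) : Summable fun k => mulTerm a b n k :=
  (summable_norm_mulTerm a b n).of_norm

lemma summable_norm_mulFun (a b : L1 σ) : Summable fun n => ‖∑' k, mulTerm a b n k‖ :=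
  Summable.of_nonneg_of_le (fun _ => norm_nonneg _)
    (fun n => norm_tsum_le_tsum_norm (summable_norm_mulTerm a b n))
    (summable_prod_norm_mulTerm a b).prod

/-- Twisted convolution: `(ab)(n) = ∑ₖ a(k) · αᵏ(b(n - k))`. -/
instance : Mul (L1 σ) :=
  ⟨fun a b => ⟨fun n => ∑' k, a k * alpha σ k (b (n - k)),
    memℓp_gen (by
      simp only [ENNReal.toReal_one, Real.rpow_one]
      exact summable_norm_mulFun a b)⟩⟩

/-- The identity element `δ⁰`. -/
instance : One (L1 σ) := ⟨single 0 1⟩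

lemma mul_apply (a b : L1 σ) (n : ℤ) : (a * b) n = ∑' k, a k * alpha σ k (b (n - k)) := rfl

lemma mul_apply' (a b : L1 σ) (n : ℤ) : (a * b) n = ∑' k, mulTerm a b n k := rfl

lemma one_def : (1 : L1 σ) = single 0 1 := rfl

lemma norm_mul_le' (a b : L1 σ) : ‖a * b‖ ≤ ‖a‖ * ‖b‖ := by
  rw [norm_eq (a * b), ← (hasSum_prod_norm a b).tsum_eq,
    (hasSum_prod_norm a b).summable.tsum_prod]
  refine (summable_norm_mulFun a b).tsum_le_tsum (fun n => ?_)
    (hasSum_prod_norm a b).summable.prod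
  exact (norm_tsum_le_tsum_norm (summable_norm_mulTerm a b n)).trans
    ((summable_norm_mulTerm a b n).tsum_le_tsum (fun k => norm_mulTerm_le a b n k)
      ((hasSum_prod_norm a b).summable.prod_factor n))

lemma add_mul' (a b c : L1 σ) : (a + b) * c = a * c + b * c := by
  ext1 n
  rw [add_apply, mul_apply', mul_apply', mul_apply',
    ← (summable_mulTerm a c n).tsum_add (summable_mulTerm b c n)]
  exact tsum_congr fun k => by simp only [mulTerm, add_apply, add_mul]

lemma mul_add' (a b c : L1 σ) : a * (b + c) = a * b + a * c := by
  ext1 n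
  rw [add_apply, mul_apply', mul_apply', mul_apply',
    ← (summable_mulTerm a b n).tsum_add (summable_mulTerm a c n)]
  exact tsum_congr fun k => by simp only [mulTerm, add_apply, map_add, mul_add]

lemma smul_mul' (z : ℂ) (a b : L1 σ) : (z • a) * b = z • (a * b) := by
  ext1 n
  rw [smul_apply, mul_apply', mul_apply', ← (summable_mulTerm a b n).tsum_const_smul]
  exact tsum_congr fun k => by simp only [mulTerm, smul_apply, smul_mul_assoc]

lemma mul_smul' (z : ℂ) (a b : L1 σ) : a * (z • b) = z • (a * b) := by
  ext1 n
  rw [smul_apply, mul_apply', mul_apply', ← (summable_mulTerm a b n).tsum_const_smul]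
  exact tsum_congr fun k => by simp only [mulTerm, smul_apply, map_smul, mul_smul_comm]

/-- `(f δᵐ)(g δⁿ) = f αᵐ(g) δᵐ⁺ⁿ`. -/
lemma single_mul_single (m n : ℤ) (f g : C(X, ℂ)) :
    (single m f * single n g : L1 σ) = single (m + n) (f * alpha σ m g) := by
  ext1 l
  rw [mul_apply, tsum_eq_single m]
  · by_cases h : l = m + n
    · simp [single_apply, h]
    · have : ¬ l - m = n := by omega
      simp [single_apply, h, this]
  · intro k hk
    simp [single_apply, hk]

/-- The multiplication as a continuous bilinear map. -/
def mulCLM (σ : X ≃ₜ X) : L1 σ →L[ℂ] L1 σ →L[ℂ] L1 σ :=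
  LinearMap.mkContinuous₂
    (LinearMap.mk₂ ℂ (fun a b : L1 σ => a * b) add_mul' smul_mul' mul_add' mul_smul') 1
    (fun a b => by simpa using norm_mul_le' a b)

@[simp] lemma mulCLM_apply (a b : L1 σ) : mulCLM σ a b = a * b := rfl

lemma mul_assoc' (a b c : L1 σ) : a * b * c = a * (b * c) := by
  have h3 : ∀ (m n : ℤ) (f g : C(X, ℂ)) (c : L1 σ),
      single m f * single n g * c = single m f * (single n g * c) := by
    intro m n f g c
    have : mulCLM σ (single m f * single n g)
        = (mulCLM σ (single m f)).comp (mulCLM σ (single n g)) := by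
      refine clm_ext fun l h => ?_
      simp only [mulCLM_apply, ContinuousLinearMap.comp_apply, single_mul_single, map_mul,
        alpha_alpha, add_assoc, mul_assoc]
    exact DFunLike.congr_fun this c
  have h2 : ∀ (m : ℤ) (f : C(X, ℂ)) (b c : L1 σ), single m f * b * c = single m f * (b * c) := by
    intro m f b c
    have : ((mulCLM σ).flip c).comp (mulCLM σ (single m f))
        = (mulCLM σ (single m f)).comp ((mulCLM σ).flip c) :=
      clm_ext fun l h => h3 m l f h c
    exact DFunLike.congr_fun this b
  have : ((mulCLM σ).flip c).comp ((mulCLM σ).flip b) = (mulCLM σ).flip (b * c) :=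
    clm_ext fun l h => h2 l h b c
  exact DFunLike.congr_fun this a

lemma one_mul' (a : L1 σ) : 1 * a = a := by
  have : mulCLM σ 1 = ContinuousLinearMap.id ℂ _ :=
    clm_ext fun n f => by simp [one_def, single_mul_single, alpha_zero]
  exact DFunLike.congr_fun this a

lemma mul_one' (a : L1 σ) : a * 1 = a := by
  have : (mulCLM σ).flip 1 = ContinuousLinearMap.id ℂ _ :=
    clm_ext fun n f => by simp [one_def, single_mul_single]
  exact DFunLike.congr_fun this a

instance : Ring (L1 σ) :=
  { (inferInstance : AddCommGroup (L1 σ)), (inferInstance : Mul (L1 σ)),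
    (inferInstance : One (L1 σ)) with
    left_distrib := mul_add'
    right_distrib := add_mul'
    zero_mul := fun a => by
      have := smul_mul' (0 : ℂ) (0 : L1 σ) a
      rwa [zero_smul, zero_smul] at this
    mul_zero := fun a => by
      have := mul_smul' (0 : ℂ) a (0 : L1 σ)
      rwa [zero_smul, zero_smul] at this
    mul_assoc := mul_assoc'
    one_mul := one_mul'
    mul_one := mul_one' }

instance : NormedRing (L1 σ) :=
  { (inferInstance : NormedAddCommGroup (L1 σ)), (inferInstance : Ring (L1 σ)) with
    norm_mul_le := norm_mul_le' }

instance : Algebra ℂ (L1 σ) := Algebra.ofModule smul_mul' mul_smul'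

instance : NormedAlgebra ℂ (L1 σ) where
  norm_smul_le := norm_smul_le

/-! #### Representations from covariant pairs -/

section IntegratedForm

variable {B : Type*} [NormedRing B] [NormedAlgebra ℂ B]

/-- A covariant pair in a Banach algebra `B`: a unital contractive homomorphism `ρ : C(X) → B` and
an invertible `T ∈ B` with `‖Tⁿ‖ ≤ 1` for all `n ∈ ℤ` and `ρ(α(f)) = T ρ(f) T⁻¹`. It is only used
to construct homomorphisms `ℓ¹(Σ) → B`, `∑ₙ fₙ δⁿ ↦ ∑ₙ ρ(fₙ) Tⁿ`. -/
structure CovariantPair (σ : X ≃ₜ X) (B : Type*) [NormedRing B] [NormedAlgebra ℂ B] where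
  rho : C(X, ℂ) →ₐ[ℂ] B
  T : Bˣ
  norm_rho_le : ∀ f, ‖rho f‖ ≤ ‖f‖
  norm_zpow_le : ∀ n : ℤ, ‖((T ^ n : Bˣ) : B)‖ ≤ 1
  covariant : ∀ f, rho (alpha σ 1 f) * T = T * rho f

variable (c : CovariantPair σ B)

lemma CovariantPair.norm_term_le (a : L1 σ) (n : ℤ) :
    ‖c.rho (a n) * ((c.T ^ n : Bˣ) : B)‖ ≤ ‖a n‖ :=
  calc _ ≤ ‖c.rho (a n)‖ * ‖((c.T ^ n : Bˣ) : B)‖ := norm_mul_le _ _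
    _ ≤ ‖a n‖ * 1 := mul_le_mul (c.norm_rho_le _) (c.norm_zpow_le n) (norm_nonneg _)
      (norm_nonneg _)
    _ = _ := mul_one _

lemma CovariantPair.covariant_zpow (n : ℤ) (f : C(X, ℂ)) :
    c.rho (alpha σ n f) * ((c.T ^ n : Bˣ) : B) = ((c.T ^ n : Bˣ) : B) * c.rho f := by
  induction n generalizing f with
  | zero => simp [alpha_zero]
  | succ n ih =>
    rw [add_comm, ← alpha_alpha, zpow_add, zpow_one, Units.val_mul, ← mul_assoc, c.covariant,
      mul_assoc, ih, mul_assoc]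
  | pred n ih =>
    have h1 : ∀ g, c.rho (alpha σ (-1) g) * ((c.T⁻¹ : Bˣ) : B)
        = ((c.T⁻¹ : Bˣ) : B) * c.rho g := by
      intro g
      have := c.covariant (alpha σ (-1) g)
      rw [alpha_alpha, show (1 + -1 : ℤ) = 0 by ring, alpha_zero] at this
      rw [Units.mul_inv_eq_iff_eq_mul, mul_assoc, this, Units.inv_mul_cancel_left]
    rw [show (-(n : ℤ) - 1) = -1 + -(n : ℤ) by ring, ← alpha_alpha, zpow_add, zpow_neg_one,
      Units.val_mul, ← mul_assoc, h1, mul_assoc, ih, mul_assoc]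

variable [CompleteSpace B]

lemma CovariantPair.summable_term (a : L1 σ) :
    Summable fun n : ℤ => c.rho (a n) * ((c.T ^ n : Bˣ) : B) :=
  Summable.of_norm_bounded a.summable_norm (c.norm_term_le a)

/-- The continuous linear map `∑ₙ fₙ δⁿ ↦ ∑ₙ ρ(fₙ) Tⁿ`. -/
def CovariantPair.integratedCLM : L1 σ →L[ℂ] B :=
  LinearMap.mkContinuous
    { toFun := fun a => ∑' n : ℤ, c.rho (a n) * ((c.T ^ n : Bˣ) : B)
      map_add' := fun a b => by
        rw [← (c.summable_term a).tsum_add (c.summable_term b)]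
        exact tsum_congr fun n => by rw [add_apply, map_add, add_mul]
      map_smul' := fun z a => by
        rw [RingHom.id_apply, ← (c.summable_term a).tsum_const_smul]
        exact tsum_congr fun n => by rw [smul_apply, map_smul, smul_mul_assoc] }
    1 fun a => by
      rw [one_mul, norm_eq]
      exact tsum_of_norm_bounded a.summable_norm.hasSum (c.norm_term_le a)

lemma CovariantPair.integratedCLM_apply (a : L1 σ) :
    c.integratedCLM a = ∑' n : ℤ, c.rho (a n) * ((c.T ^ n : Bˣ) : B) := rfl

lemma CovariantPair.integratedCLM_single (n : ℤ) (f : C(X, ℂ)) :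
    c.integratedCLM (single n f) = c.rho f * ((c.T ^ n : Bˣ) : B) := by
  rw [c.integratedCLM_apply, tsum_eq_single n]
  · simp [single_apply]
  · intro k hk
    simp [single_apply, hk]

lemma CovariantPair.integratedCLM_mul (a b : L1 σ) :
    c.integratedCLM (a * b) = c.integratedCLM a * c.integratedCLM b := by
  have h2 : ∀ (m : ℤ) (f : C(X, ℂ)) (b : L1 σ),
      c.integratedCLM (single m f * b) = c.integratedCLM (single m f) * c.integratedCLM b := by
    intro m f b
    have : c.integratedCLM.comp (mulCLM σ (single m f))
        = (ContinuousLinearMap.mul ℂ B (c.integratedCLM (single m f))).comp c.integratedCLM := by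
      refine clm_ext fun n g => ?_
      simp only [ContinuousLinearMap.comp_apply, mulCLM_apply, single_mul_single,
        ContinuousLinearMap.mul_apply', c.integratedCLM_single, map_mul, zpow_add, Units.val_mul]
      simp only [mul_assoc]
      rw [← mul_assoc (c.rho (alpha σ m g)), c.covariant_zpow]
      simp only [mul_assoc]
    exact DFunLike.congr_fun this b
  have : c.integratedCLM.comp ((mulCLM σ).flip b)
      = ((ContinuousLinearMap.mul ℂ B).flip (c.integratedCLM b)).comp c.integratedCLM :=
    clm_ext fun n f => h2 n f b
  exact DFunLike.congr_fun this a

/-- The unital homomorphism `ℓ¹(Σ) → B`, `∑ₙ fₙ δⁿ ↦ ∑ₙ ρ(fₙ) Tⁿ`. -/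
def CovariantPair.integrated : L1 σ →ₐ[ℂ] B :=
  AlgHom.ofLinearMap (c.integratedCLM : L1 σ →ₗ[ℂ] B)
    (by simpa [one_def] using c.integratedCLM_single 0 1) c.integratedCLM_mul

lemma CovariantPair.integrated_apply (a : L1 σ) :
    c.integrated a = ∑' n : ℤ, c.rho (a n) * ((c.T ^ n : Bˣ) : B) := rfl

lemma CovariantPair.integrated_mul_T (c c' : CovariantPair σ B) (hT : c'.T = c.T)
    (hrho : ∀ f, c'.rho f = c.rho (alpha σ (-1) f)) (a : L1 σ) :
    c.integrated a * c.T = c.T * c'.integrated a := by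
  rw [CovariantPair.integrated_apply, CovariantPair.integrated_apply,
    ← (c.summable_term a).tsum_mul_right (c.T : B),
    ← (c'.summable_term a).tsum_mul_left (c.T : B)]
  refine tsum_congr fun n => ?_
  have h2 := c.covariant (alpha σ (-1) (a n))
  rw [alpha_alpha, add_neg_cancel, alpha_zero] at h2
  have h3 : ((c.T ^ n : Bˣ) : B) * (c.T : B) = (c.T : B) * ((c.T ^ n : Bˣ) : B) :=
    (Units.ext_iff.1 ((Commute.refl c.T).zpow_left n).eq)
  rw [hrho, hT, mul_assoc, h3, ← mul_assoc, ← mul_assoc, h2]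

end IntegratedForm

end L1

open L1

/-! ### Orbits -/

/-- The orbit `ℤ · x`. -/
def orbit (σ : X ≃ₜ X) (x : X) : Set X := Set.range fun n : ℤ => (σ ^ n : X ≃ₜ X) x

/-! ### The finite dimensional representations `π_{x,λ}` -/

section Finite

/-- `ρₓ(f) = diag(f(x), f(σx), …, f(σᵖ⁻¹x))`. -/
def rhoMatrix (σ : X ≃ₜ X) (p : ℕ) (x : X) : C(X, ℂ) →⋆ₐ[ℂ] Matrix (Fin p) (Fin p) ℂ where
  toFun f := Matrix.diagonal fun i => f (σ^[i] x)
  map_one' := by simp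
  map_mul' f g := by simp [Matrix.diagonal_mul_diagonal]
  map_zero' := by simp
  map_add' f g := by simp [Matrix.diagonal_add]
  commutes' z := by
    ext i j
    simp [Matrix.algebraMap_matrix_apply, Matrix.diagonal_apply]
  map_star' f := by
    ext i j
    by_cases h : i = j
    · simp [h]
    · simp [Matrix.star_apply, h, Ne.symm h]

/-- The matrix `T_λ`, with entries `1` just below the diagonal, `λ` in the upper right corner, and
zeros elsewhere (`j + 1` is taken cyclically in `Fin p`; for `p = 1` this is `(λ)`). -/
def shiftMatrix (p : ℕ) [NeZero p] (l : Circle) : Matrix (Fin p) (Fin p) ℂ :=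
  Matrix.of fun i j => if j + 1 = i then (if i = 0 then (l : ℂ) else 1) else 0

lemma shiftMatrix_mul_star (p : ℕ) [NeZero p] (l : Circle) :
    shiftMatrix p l * star (shiftMatrix p l) = 1 := by
  ext i k
  rw [Matrix.mul_apply, Finset.sum_eq_single (i - 1)]
  · by_cases h : i = k
    · subst h
      by_cases h0 : i = 0
      · simp [shiftMatrix, Matrix.star_apply, h0, Complex.mul_conj]
      · simp [shiftMatrix, Matrix.star_apply, h0]
    · simp [shiftMatrix, Matrix.star_apply, h]
  · intro j _ hj
    have : j + 1 ≠ i := fun h => hj (eq_sub_of_add_eq h)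
    simp [shiftMatrix, this]
  · simp

lemma shiftMatrix_mem_unitary (p : ℕ) [NeZero p] (l : Circle) :
    shiftMatrix p l ∈ unitary (Matrix (Fin p) (Fin p) ℂ) :=
  Unitary.mem_iff.2 ⟨mul_eq_one_comm.1 (shiftMatrix_mul_star p l), shiftMatrix_mul_star p l⟩

lemma rhoMatrix_covariant (σ : X ≃ₜ X) (p : ℕ) [NeZero p] (x : X)
    (hx : Function.IsPeriodicPt σ p x) (l : Circle) (f : C(X, ℂ)) :
    rhoMatrix σ p x (alpha σ 1 f) * shiftMatrix p l = shiftMatrix p l * rhoMatrix σ p x f := by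
  ext i j
  change ((Matrix.diagonal fun i : Fin p => alpha σ 1 f (σ^[i] x)) * shiftMatrix p l) i j
    = (shiftMatrix p l * Matrix.diagonal fun i : Fin p => f (σ^[i] x)) i j
  rw [Matrix.diagonal_mul, Matrix.mul_diagonal, mul_comm]
  by_cases h : j + 1 = i
  · congr 1
    subst h
    have h1 : σ^[((j + 1 : Fin p) : ℕ)] x = σ (σ^[(j : ℕ)] x) := by
      rw [← Function.iterate_succ_apply' (⇑σ), Fin.val_add, hx.iterate_mod_apply,
        Function.iterate_add_apply, Fin.val_one', hx.iterate_mod_apply]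
      rfl
    rw [h1, alpha_apply, zpow_neg_one]
    exact congrArg f (σ.symm_apply_apply _)
  · simp [shiftMatrix, h]

/-- Matrices as operators on the Hilbert space `ℂᵖ`. -/
def matOp (p : ℕ) : Matrix (Fin p) (Fin p) ℂ →⋆ₐ[ℂ]
    (EuclideanSpace ℂ (Fin p) →L[ℂ] EuclideanSpace ℂ (Fin p)) :=
  StarAlgHomClass.toStarAlgHom (Matrix.toEuclideanCLM (n := Fin p) (𝕜 := ℂ))

/-- `T_λ` as a unitary operator on `ℂᵖ`. -/
def shiftUnitary (p : ℕ) [NeZero p] (l : Circle) :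
    unitary (EuclideanSpace ℂ (Fin p) →L[ℂ] EuclideanSpace ℂ (Fin p)) :=
  ⟨matOp p (shiftMatrix p l), Unitary.map_mem (matOp p) (shiftMatrix_mem_unitary p l)⟩

/-- The covariant pair `(ρₓ, T_λ)` on the Hilbert space `ℂᵖ`, for a point `x` with `σᵖ x = x`. -/
def finitePair (σ : X ≃ₜ X) (p : ℕ) [NeZero p] (x : X)
    (hx : Function.IsPeriodicPt σ p x) (l : Circle) :
    CovariantPair σ (EuclideanSpace ℂ (Fin p) →L[ℂ] EuclideanSpace ℂ (Fin p)) where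
  rho := ((matOp p).comp (rhoMatrix σ p x)).toAlgHom
  T := Unitary.toUnits (shiftUnitary p l)
  norm_rho_le f := NonUnitalStarAlgHom.norm_apply_le ((matOp p).comp (rhoMatrix σ p x)) f
  norm_zpow_le n := by
    rw [← map_zpow]
    exact (CStarRing.norm_of_mem_unitary (shiftUnitary p l ^ n).2).le
  covariant f := by
    have := congrArg (matOp p) (rhoMatrix_covariant σ p x hx l f)
    rwa [map_mul, map_mul] at this

/-- The representation `π_{x,λ}` of `ℓ¹(Σ)` on `ℂᵖ`, where `p` is the period of the periodic
point `x` and `λ ∈ 𝕋`: it sends `f ∈ C(X)` to `ρₓ(f)` and `δ` to `T_λ`. -/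
def piFinite (σ : X ≃ₜ X) (x : X) (hx : x ∈ Function.periodicPts σ) (l : Circle) :
    L1 σ →ₐ[ℂ] (EuclideanSpace ℂ (Fin (Function.minimalPeriod σ x)) →L[ℂ]
      EuclideanSpace ℂ (Fin (Function.minimalPeriod σ x))) :=
  haveI : NeZero (Function.minimalPeriod σ x) :=
    ⟨(Function.minimalPeriod_pos_of_mem_periodicPts hx).ne'⟩
  (finitePair σ (Function.minimalPeriod σ x) x (Function.isPeriodicPt_minimalPeriod σ x)
    l).integrated

end Finite

/-! ### The infinite dimensional representations `π_x¹` on `ℓ¹(ℤ)` -/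

section Infinite

/-- The Banach space `ℓ¹(ℤ)`. -/
abbrev l1Z : Type := lp (fun _ : ℤ => ℂ) 1

lemma l1Z_summable (ξ : l1Z) : Summable fun k => ‖ξ k‖ := by
  simpa using (lp.memℓp ξ).summable (by simp)

lemma l1Z_norm (ξ : l1Z) : ‖ξ‖ = ∑' k, ‖ξ k‖ := by
  simpa using lp.norm_eq_tsum_rpow (p := 1) (by simp) ξ

lemma l1Z_memlp {ξ : ℤ → ℂ} (h : Summable fun k => ‖ξ k‖) : Memℓp ξ 1 :=
  memℓp_gen (by simpa using h)

lemma summable_mul_l1Z (σ : X ≃ₜ X) (x : X) (f : C(X, ℂ)) (ξ : l1Z) :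
    Summable fun k : ℤ => ‖f ((σ ^ k : X ≃ₜ X) x) * ξ k‖ :=
  Summable.of_nonneg_of_le (fun _ => norm_nonneg _)
    (fun _ => (norm_mul_le _ _).trans
      (mul_le_mul_of_nonneg_right (f.norm_coe_le_norm _) (norm_nonneg _)))
    ((l1Z_summable ξ).mul_left ‖f‖)

/-- The operator on `ℓ¹(ℤ)` with `e_k ↦ f(σᵏ x) e_k`. -/
def mulOp (σ : X ≃ₜ X) (x : X) (f : C(X, ℂ)) : l1Z →L[ℂ] l1Z :=
  LinearMap.mkContinuous
    { toFun := fun ξ => ⟨fun k => f ((σ ^ k : X ≃ₜ X) x) * ξ k,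
        l1Z_memlp (summable_mul_l1Z σ x f ξ)⟩
      map_add' := fun ξ η => lp.ext (funext fun k => mul_add _ _ _)
      map_smul' := fun z ξ => lp.ext (funext fun k =>
        mul_smul_comm z (f ((σ ^ k : X ≃ₜ X) x)) (ξ k)) }
    ‖f‖ fun ξ => by
      rw [l1Z_norm, l1Z_norm, ← tsum_mul_left]
      exact (summable_mul_l1Z σ x f ξ).tsum_le_tsum
        (fun k => (norm_mul_le _ _).trans
          (mul_le_mul_of_nonneg_right (f.norm_coe_le_norm _) (norm_nonneg _)))
        ((l1Z_summable ξ).mul_left ‖f‖)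

@[simp] lemma mulOp_apply (σ : X ≃ₜ X) (x : X) (f : C(X, ℂ)) (ξ : l1Z) (k : ℤ) :
    mulOp σ x f ξ k = f ((σ ^ k : X ≃ₜ X) x) * ξ k := rfl

lemma norm_mulOp_le (σ : X ≃ₜ X) (x : X) (f : C(X, ℂ)) : ‖mulOp σ x f‖ ≤ ‖f‖ :=
  LinearMap.mkContinuous_norm_le _ (norm_nonneg _) _

/-- The translation operator on `ℓ¹(ℤ)` with `e_k ↦ e_{k+n}`. -/
def shiftOp (n : ℤ) : l1Z →L[ℂ] l1Z :=
  LinearMap.mkContinuous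
    { toFun := fun ξ => ⟨fun k => ξ (k - n),
        l1Z_memlp ((Equiv.subRight n).summable_iff.2 (l1Z_summable ξ))⟩
      map_add' := fun ξ η => rfl
      map_smul' := fun z ξ => rfl }
    1 fun ξ => by
      rw [l1Z_norm, l1Z_norm, one_mul]
      exact ((Equiv.subRight n).tsum_eq fun k => ‖ξ k‖).le

@[simp] lemma shiftOp_apply (n : ℤ) (ξ : l1Z) (k : ℤ) : shiftOp n ξ k = ξ (k - n) := rfl

lemma shiftOp_mul (m n : ℤ) : shiftOp m * shiftOp n = shiftOp (m + n) := by
  ext1 ξ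
  refine lp.ext (funext fun k => ?_)
  simp [sub_sub]

lemma shiftOp_zero : shiftOp 0 = 1 := by
  ext1 ξ
  refine lp.ext (funext fun k => ?_)
  simp

/-- The right shift `S` on `ℓ¹(ℤ)`, `S e_k = e_{k+1}`. -/
def shiftUnit : (l1Z →L[ℂ] l1Z)ˣ where
  val := shiftOp 1
  inv := shiftOp (-1)
  val_inv := by rw [shiftOp_mul, add_neg_cancel, shiftOp_zero]
  inv_val := by rw [shiftOp_mul, neg_add_cancel, shiftOp_zero]

lemma shiftUnit_zpow (n : ℤ) : ((shiftUnit ^ n : (l1Z →L[ℂ] l1Z)ˣ) : l1Z →L[ℂ] l1Z) = shiftOp n := by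
  induction n with
  | zero => simp [shiftOp_zero]
  | succ n ih => rw [zpow_add, Units.val_mul, ih, zpow_one, ← shiftOp_mul]; rfl
  | pred n ih =>
    rw [sub_eq_add_neg, zpow_add, Units.val_mul, ih, zpow_neg_one, ← shiftOp_mul]; rfl

/-- The covariant pair on `ℓ¹(ℤ)` consisting of the multiplication operators
`e_k ↦ f(σᵏ x) e_k` and the right shift. -/
def infinitePair (σ : X ≃ₜ X) (x : X) : CovariantPair σ (l1Z →L[ℂ] l1Z) where
  rho := AlgHom.ofLinearMap
    { toFun := mulOp σ x
      map_add' := fun f g => by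
        ext1 ξ
        exact lp.ext (funext fun k =>
          add_mul (f ((σ ^ k : X ≃ₜ X) x)) (g ((σ ^ k : X ≃ₜ X) x)) (ξ k))
      map_smul' := fun z f => by
        ext1 ξ
        exact lp.ext (funext fun k =>
          smul_mul_assoc z (f ((σ ^ k : X ≃ₜ X) x)) (ξ k)) }
    (by
      ext1 ξ
      exact lp.ext (funext fun k => one_mul (ξ k)))
    (fun f g => by
      ext1 ξ
      exact lp.ext (funext fun k =>
        mul_assoc (f ((σ ^ k : X ≃ₜ X) x)) (g ((σ ^ k : X ≃ₜ X) x)) (ξ k)))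
  T := shiftUnit
  norm_rho_le := norm_mulOp_le σ x
  norm_zpow_le n := by
    rw [shiftUnit_zpow]
    exact LinearMap.mkContinuous_norm_le _ zero_le_one _
  covariant f := by
    ext1 ξ
    refine lp.ext (funext fun k => ?_)
    change f ((σ ^ (-1 : ℤ) : X ≃ₜ X) ((σ ^ k : X ≃ₜ X) x)) * ξ (k - 1)
      = f ((σ ^ (k - 1) : X ≃ₜ X) x) * ξ (k - 1)
    rw [sub_eq_neg_add, zpow_add]
    rfl

/-- The representation `π_x¹` of `ℓ¹(Σ)` on `ℓ¹(ℤ)`: it sends `f ∈ C(X)` to the operator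
`e_k ↦ f(σᵏ x) e_k` and `δ` to the right shift. -/
def piInfinite (σ : X ≃ₜ X) (x : X) : L1 σ →ₐ[ℂ] (l1Z →L[ℂ] l1Z) :=
  (infinitePair σ x).integrated

end Infinite

/-! ### The kernels depend only on the orbit closure -/

section WellDefined

lemma integrated_shift {σ : X ≃ₜ X} (p : ℕ) [NeZero p] (x : X)
    (hx : Function.IsPeriodicPt σ p x) (hx' : Function.IsPeriodicPt σ p (σ x)) (l : Circle)
    (a : L1 σ) :
    (finitePair σ p x hx l).integrated a * (finitePair σ p x hx l).T
      = (finitePair σ p x hx l).T * (finitePair σ p (σ x) hx' l).integrated a := by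
  refine CovariantPair.integrated_mul_T (finitePair σ p x hx l) (finitePair σ p (σ x) hx' l) rfl
    (fun f => ?_) a
  change matOp p (rhoMatrix σ p (σ x) f) = matOp p (rhoMatrix σ p x (alpha σ (-1) f))
  congr 1
  change Matrix.diagonal _ = Matrix.diagonal _
  congr 1
  funext i
  rw [alpha_apply, ← Function.iterate_succ_apply, Function.iterate_succ_apply', neg_neg, zpow_one]

lemma integrated_eq_zero_shift {σ : X ≃ₜ X} (p : ℕ) [NeZero p] (x : X)
    (hx : Function.IsPeriodicPt σ p x) (hx' : Function.IsPeriodicPt σ p (σ x)) (l : Circle)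
    (a : L1 σ) :
    (finitePair σ p (σ x) hx' l).integrated a = 0 ↔ (finitePair σ p x hx l).integrated a = 0 := by
  have h := integrated_shift p x hx hx' l a
  constructor <;> intro h0
  · rwa [h0, mul_zero, Units.mul_left_eq_zero] at h
  · rw [h0, zero_mul, eq_comm, Units.mul_right_eq_zero] at h
    exact h

lemma integrated_eq_zero_congr {σ : X ≃ₜ X} {p q : ℕ} [NeZero p] [NeZero q] (h : p = q) (x : X)
    (hx : Function.IsPeriodicPt σ p x) (hx' : Function.IsPeriodicPt σ q x) (l : Circle)
    (a : L1 σ) :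
    (finitePair σ p x hx l).integrated a = 0 ↔ (finitePair σ q x hx' l).integrated a = 0 := by
  subst h
  rfl

lemma piFinite_eq_zero_shift {σ : X ≃ₜ X} {x : X} (hx : x ∈ Function.periodicPts σ)
    (hx' : σ x ∈ Function.periodicPts σ) (l : Circle) (a : L1 σ) :
    piFinite σ (σ x) hx' l a = 0 ↔ piFinite σ x hx l a = 0 := by
  have : NeZero (Function.minimalPeriod σ x) :=
    ⟨(Function.minimalPeriod_pos_of_mem_periodicPts hx).ne'⟩
  have : NeZero (Function.minimalPeriod σ (σ x)) :=
    ⟨(Function.minimalPeriod_pos_of_mem_periodicPts hx').ne'⟩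
  have hm := Function.minimalPeriod_apply hx
  have hp : Function.IsPeriodicPt σ (Function.minimalPeriod σ x) (σ x) := by
    rw [← hm]
    exact Function.isPeriodicPt_minimalPeriod σ (σ x)
  exact (integrated_eq_zero_congr hm (σ x) _ hp l a).trans
    (integrated_eq_zero_shift _ x (Function.isPeriodicPt_minimalPeriod σ x) hp l a)

lemma ker_piFinite_iterate {σ : X ≃ₜ X} {x y : X} (hx : x ∈ Function.periodicPts σ)
    (hy : y ∈ Function.periodicPts σ) (m : ℕ) (h : σ^[m] x = y) (l : Circle) (a : L1 σ) :
    piFinite σ y hy l a = 0 ↔ piFinite σ x hx l a = 0 := by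
  induction m generalizing y with
  | zero =>
    obtain rfl : x = y := h
    rfl
  | succ m ih =>
    rw [Function.iterate_succ_apply'] at h
    have hz : σ^[m] x ∈ Function.periodicPts σ := by
      obtain ⟨n, hn, hp⟩ := hx
      exact ⟨n, hn, hp.apply_iterate m⟩
    subst h
    exact (piFinite_eq_zero_shift hz hy l a).trans (ih hz rfl)

lemma zpow_natCast_apply (σ : X ≃ₜ X) (m : ℕ) (x : X) : (σ ^ (m : ℤ) : X ≃ₜ X) x = σ^[m] x := by
  induction m with
  | zero => rfl
  | succ m ih =>
    rw [Function.iterate_succ_apply', ← ih, Nat.cast_succ, add_comm, zpow_add, zpow_one]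
    rfl

lemma mem_closure_orbit (σ : X ≃ₜ X) (x : X) : x ∈ closure (orbit σ x) :=
  subset_closure ⟨0, rfl⟩

lemma exists_iterate_of_mem_orbit {σ : X ≃ₜ X} {x y : X} (hx : x ∈ Function.periodicPts σ)
    (hy : y ∈ orbit σ x) : ∃ m : ℕ, m < Function.minimalPeriod σ x ∧ σ^[m] x = y := by
  obtain ⟨n, rfl⟩ := hy
  have hp := Function.minimalPeriod_pos_of_mem_periodicPts hx
  set p := Function.minimalPeriod σ x with hpdef
  have hfix : (σ ^ (p : ℤ) : X ≃ₜ X) x = x := by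
    rw [zpow_natCast_apply]
    exact Function.isPeriodicPt_minimalPeriod σ x
  have hfix2 : ∀ q : ℤ, (σ ^ ((p : ℤ) * q) : X ≃ₜ X) x = x := by
    intro q
    rw [zpow_mul]
    induction q with
    | zero => rfl
    | succ q ih =>
      rw [zpow_add, zpow_one]
      change ((σ ^ (p : ℤ)) ^ (q : ℤ) : X ≃ₜ X) ((σ ^ (p : ℤ) : X ≃ₜ X) x) = x
      rw [hfix, ih]
    | pred q ih =>
      rw [zpow_sub, zpow_one]
      change ((σ ^ (p : ℤ)) ^ (-q : ℤ) : X ≃ₜ X) ((σ ^ (p : ℤ) : X ≃ₜ X).symm x) = x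
      rw [(Homeomorph.symm_apply_eq _).2 hfix.symm, ih]
  have hp0 : (p : ℤ) ≠ 0 := by omega
  refine ⟨(n % p).toNat, ?_, ?_⟩
  · have h1 := Int.emod_lt_of_pos n (show (0 : ℤ) < p by omega)
    have h2 := Int.emod_nonneg n hp0
    omega
  · rw [← zpow_natCast_apply, Int.toNat_of_nonneg (Int.emod_nonneg n hp0)]
    beta_reduce
    conv_rhs => rw [← Int.emod_add_mul_ediv n p, zpow_add]
    change _ = (σ ^ (n % (p : ℤ)) : X ≃ₜ X) ((σ ^ ((p : ℤ) * (n / p)) : X ≃ₜ X) x)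
    rw [hfix2]

lemma closure_orbit_of_periodic [T2Space X] {σ : X ≃ₜ X} {x : X}
    (hx : x ∈ Function.periodicPts σ) : closure (orbit σ x) = orbit σ x := by
  refine IsClosed.closure_eq (Set.Finite.isClosed ?_)
  refine ((Set.finite_Iio (Function.minimalPeriod σ x)).image fun m => σ^[m] x).subset ?_
  intro y hy
  obtain ⟨m, hm, h⟩ := exists_iterate_of_mem_orbit hx hy
  exact ⟨m, hm, h⟩

lemma ker_piFinite_eq [T2Space X] {σ : X ≃ₜ X} {x y : X} (hx : x ∈ Function.periodicPts σ)
    (hy : y ∈ Function.periodicPts σ) (h : closure (orbit σ x) = closure (orbit σ y))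
    (l : Circle) : TwoSidedIdeal.ker (piFinite σ x hx l) = TwoSidedIdeal.ker (piFinite σ y hy l) := by
  have hxy : x ∈ orbit σ y := by
    rw [← closure_orbit_of_periodic hy, ← h]
    exact mem_closure_orbit σ x
  obtain ⟨m, -, hm⟩ := exists_iterate_of_mem_orbit hy hxy
  ext a
  rw [TwoSidedIdeal.mem_ker, TwoSidedIdeal.mem_ker]
  exact ker_piFinite_iterate hy hx m hm l a

lemma piInfinite_single_apply (σ : X ≃ₜ X) (x : X) (a : L1 σ) (j k : ℤ) :
    piInfinite σ x a (lp.single 1 j (1 : ℂ)) k = a (k - j) ((σ ^ k : X ≃ₜ X) x) := by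
  have h : HasSum (fun n : ℤ => (infinitePair σ x).rho (a n) *
      (((infinitePair σ x).T ^ n : (l1Z →L[ℂ] l1Z)ˣ) : l1Z →L[ℂ] l1Z)) (piInfinite σ x a) :=
    ((infinitePair σ x).summable_term a).hasSum
  have h2 := h.mapL (ContinuousLinearMap.apply ℂ l1Z (lp.single 1 j (1 : ℂ) : l1Z))
  have h3 := h2.mapL (lp.evalCLM ℂ (fun _ : ℤ => ℂ) 1 k)
  have key : ∀ n : ℤ, lp.evalCLM ℂ (fun _ : ℤ => ℂ) 1 k
      (ContinuousLinearMap.apply ℂ l1Z (lp.single 1 j (1 : ℂ) : l1Z)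
        ((infinitePair σ x).rho (a n) *
          (((infinitePair σ x).T ^ n : (l1Z →L[ℂ] l1Z)ˣ) : l1Z →L[ℂ] l1Z)))
      = if n = k - j then a n ((σ ^ k : X ≃ₜ X) x) else 0 := by
    intro n
    have hz : (((infinitePair σ x).T ^ n : (l1Z →L[ℂ] l1Z)ˣ) : l1Z →L[ℂ] l1Z) = shiftOp n :=
      shiftUnit_zpow n
    rw [hz]
    change a n ((σ ^ k : X ≃ₜ X) x) * (lp.single 1 j (1 : ℂ) : l1Z) (k - n) = _
    rw [lp.single_apply, Pi.single_apply]
    by_cases hn : n = k - j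
    · rw [if_pos hn, if_pos (by omega), mul_one]
    · rw [if_neg hn, if_neg (by omega), mul_zero]
  have h4 : HasSum (fun n : ℤ => if n = k - j then a n ((σ ^ k : X ≃ₜ X) x) else 0)
      (piInfinite σ x a (lp.single 1 j (1 : ℂ)) k) := by
    simp only [key] at h3
    exact h3
  have h5 := hasSum_single (f := fun n : ℤ => if n = k - j then a n ((σ ^ k : X ≃ₜ X) x) else 0)
    (k - j) fun n hn => if_neg hn
  rw [if_pos rfl] at h5
  exact h4.unique h5

lemma piInfinite_eq_zero_iff (σ : X ≃ₜ X) (x : X) (a : L1 σ) :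
    piInfinite σ x a = 0 ↔ ∀ n, ∀ y ∈ closure (orbit σ x), a n y = 0 := by
  constructor
  · intro h n y hy
    have hcl : IsClosed {y | a n y = 0} := isClosed_eq (a n).continuous continuous_const
    refine closure_minimal ?_ hcl hy
    rintro _ ⟨k, rfl⟩
    have := piInfinite_single_apply σ x a (k - n) k
    rw [h, sub_sub_cancel] at this
    exact this.symm
  · intro h
    rw [piInfinite, CovariantPair.integrated_apply]
    refine (tsum_congr fun n => ?_).trans tsum_zero
    have : (infinitePair σ x).rho (a n) = 0 := by
      ext1 ξ
      refine lp.ext (funext fun k => ?_)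
      change a n ((σ ^ k : X ≃ₜ X) x) * ξ k = 0
      rw [h n _ (subset_closure ⟨k, rfl⟩), zero_mul]
    rw [this, zero_mul]

lemma ker_piInfinite_eq {σ : X ≃ₜ X} {x y : X} (h : closure (orbit σ x) = closure (orbit σ y)) :
    TwoSidedIdeal.ker (piInfinite σ x) = TwoSidedIdeal.ker (piInfinite σ y) := by
  ext a
  rw [TwoSidedIdeal.mem_ker, TwoSidedIdeal.mem_ker, piInfinite_eq_zero_iff, piInfinite_eq_zero_iff, h]

end WellDefined

/-! ### The primitive ideals associated with orbit closures -/

/-- The (closures of) orbits of periodic points. -/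
def periodicOrbitClosures (σ : X ≃ₜ X) : Set (Set X) :=
  {C | ∃ x, x ∈ Function.periodicPts σ ∧ closure (orbit σ x) = C}

/-- The closures of orbits of aperiodic points. -/
def aperiodicOrbitClosures (σ : X ≃ₜ X) : Set (Set X) :=
  {C | ∃ x, x ∉ Function.periodicPts σ ∧ closure (orbit σ x) = C}

/-- `P_{C,λ} = Ker π_{x,λ}`, where `x` is any periodic point whose orbit has closure `C`; the
choice of `x` is immaterial by `idealFinite_eq`. -/
def idealFinite (σ : X ≃ₜ X) (C : periodicOrbitClosures σ) (l : Circle) : TwoSidedIdeal (L1 σ) :=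
  TwoSidedIdeal.ker (piFinite σ C.2.choose C.2.choose_spec.1 l)

/-- `P_C = Ker π_x¹`, where `x` is any aperiodic point whose orbit has closure `C`; the
choice of `x` is immaterial by `idealInfinite_eq`. -/
def idealInfinite (σ : X ≃ₜ X) (C : aperiodicOrbitClosures σ) : TwoSidedIdeal (L1 σ) :=
  TwoSidedIdeal.ker (piInfinite σ C.2.choose)

lemma idealFinite_eq [T2Space X] (σ : X ≃ₜ X) (x : X) (hx : x ∈ Function.periodicPts σ)
    (l : Circle) :
    idealFinite σ ⟨closure (orbit σ x), x, hx, rfl⟩ l = TwoSidedIdeal.ker (piFinite σ x hx l) :=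
  ker_piFinite_eq _ hx (Exists.choose_spec (⟨x, hx, rfl⟩ : ∃ y, y ∈ Function.periodicPts σ ∧
    closure (orbit σ y) = closure (orbit σ x))).2 l

lemma idealInfinite_eq (σ : X ≃ₜ X) (x : X) (hx : x ∉ Function.periodicPts σ) :
    idealInfinite σ ⟨closure (orbit σ x), x, hx, rfl⟩ = TwoSidedIdeal.ker (piInfinite σ x) :=
  ker_piInfinite_eq (Exists.choose_spec (⟨x, hx, rfl⟩ : ∃ y, y ∉ Function.periodicPts σ ∧
    closure (orbit σ y) = closure (orbit σ x))).2

end DynSys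

end

/-! Both families of representations are algebraically transitive: every nonzero vector ξ can be
sent to any prescribed vector by some element of the algebra. There is then no proper nonzero
invariant subspace, so the kernel is primitive (`isPrimitiveIdeal_ker`).

For periodic x the points x, σx, …, σᵖ⁻¹x are distinct. Urysohn's lemma gives a function that cuts ξ
down to one basis vector, which powers of T_λ then move to all the others
(`exists_integrated_finitePair_eq`).

For aperiodic x a single Urysohn function can only kill finitely many coordinates, so e₀ is reached
approximately: after a shift and a rescaling, some π(b)ξ lies within distance 1 of e₀
(`exists_piInfinite_norm_lt`). The vector e₀ itself is cyclic with an explicit contractive solution,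
since π(∑ζₙδⁿ)e₀ = ζ. Replacing e₀ by π(b)ξ perturbs the identity operator ζ ↦ ζ by less than 1 in
norm, and a Neumann series makes the perturbed operator invertible
(`exists_piInfinite_eq_of_norm_lt`).

For the intersection, let a lie in all the kernels and fix a point x. If x is aperiodic, the matrix
entries of π_x¹(a) are the values of the coefficients of a along the orbit, so these vanish. If x is
periodic, the entries of π_{x,λ}(a) are, up to powers of λ, absolutely convergent Fourier series in
λ whose coefficients are values a(n)(x); vanishing for all λ ∈ 𝕋 forces each of them to be zero
(`eq_zero_of_hasSum_circle_zpow`). Semisimplicity follows because the radical lies in every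
primitive ideal. -/

noncomputable section

namespace DynSys

universe u

open L1

/-! ### Kernels of transitive representations are primitive -/

/-- The (unital) action of the operators on a normed space `F` on a copy of `F` in a larger
universe. -/
def uliftOpHom (F : Type) [NormedAddCommGroup F] [NormedSpace ℂ F] :
    (F →L[ℂ] F) →ₐ[ℂ] Module.End ℂ (ULift.{u} F) where
  toFun S := (ULift.moduleEquiv (R := ℂ) (M := F)).symm.toLinearMap ∘ₗ (S : F →ₗ[ℂ] F) ∘ₗ
    (ULift.moduleEquiv (R := ℂ) (M := F)).toLinearMap
  map_one' := rfl
  map_mul' _ _ := rfl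
  map_zero' := rfl
  map_add' _ _ := rfl
  commutes' _ := rfl

/-- Ensures that passing to the copy in the larger universe does not change the kernel. -/
lemma uliftOpHom_eq_zero_iff {F : Type} [NormedAddCommGroup F] [NormedSpace ℂ F]
    (S : F →L[ℂ] F) : uliftOpHom.{u} F S = 0 ↔ S = 0 := by
  refine ⟨fun h => ?_, fun h => by rw [h, map_zero]⟩
  ext1 v
  exact congrArg ULift.down (LinearMap.congr_fun h (ULift.up v))

/-- If every nonzero vector is cyclic in the algebraic sense, the kernel is primitive. -/
lemma isPrimitiveIdeal_ker {A : Type u} [Ring A] [Algebra ℂ A] {F : Type} [NormedAddCommGroup F]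
    [NormedSpace ℂ F] [Nontrivial F] (π : A →ₐ[ℂ] (F →L[ℂ] F))
    (h : ∀ ξ : F, ξ ≠ 0 → ∀ η, ∃ a, π a ξ = η) : IsPrimitiveIdeal (TwoSidedIdeal.ker π) := by
  -- `IsPrimitiveIdeal` asks for a space in the universe of `A`, whereas `F` lives in `Type`.
  refine ⟨ULift.{u} F, inferInstance, inferInstance,
    (((uliftOpHom F).comp π : A →ₐ[ℂ] _) : A →ₙₐ[ℂ] Module.End ℂ (ULift.{u} F)),
    ⟨?_, fun W hW => ?_⟩, ?_⟩
  · obtain ⟨ξ, hξ⟩ := exists_ne (0 : F)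
    refine ⟨1, ULift.up ξ, fun h0 => hξ ?_⟩
    have := congrArg ULift.down h0
    change (uliftOpHom.{u} F (π 1) (ULift.up ξ)).down = 0 at this
    rwa [map_one, map_one] at this
  · refine or_iff_not_imp_left.2 fun hne => ?_
    obtain ⟨e, he, he0⟩ := W.ne_bot_iff.1 hne
    refine W.eq_top_iff'.2 fun e' => ?_
    obtain ⟨a, ha⟩ := h e.down (fun h0 => he0 (ULift.ext _ _ h0)) e'.down
    have := hW a e he
    change ULift.up (π a e.down) ∈ W at this
    rwa [ha] at this
  · ext a
    rw [TwoSidedIdeal.mem_ker, TwoSidedIdeal.mem_ker]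
    exact (uliftOpHom_eq_zero_iff (π a)).symm

/-! ### Separating a point from a finite set -/

/-- Urysohn's lemma for a finite, hence closed, set. The bound by 1 controls the coordinates outside
a finite set in the aperiodic case. -/
lemma exists_continuousMap_eq_one_zero {X : Type*} [TopologicalSpace X] [CompactSpace X]
    [T2Space X] {x : X} {F : Set X} (hF : F.Finite) (hx : x ∉ F) :
    ∃ f : C(X, ℂ), f x = 1 ∧ (∀ y ∈ F, f y = 0) ∧ ∀ y, ‖f y‖ ≤ 1 := by
  obtain ⟨f, h0, h1, h⟩ := exists_continuous_zero_one_of_isClosed hF.isClosed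
    (isClosed_singleton (x := x)) (Set.disjoint_singleton_right.2 hx)
  refine ⟨⟨fun y => (f y : ℂ), by fun_prop⟩, ?_, fun y hy => ?_, fun y => ?_⟩
  · simpa using h1 rfl
  · simpa using h0 hy
  · simpa [abs_of_nonneg (h y).1] using (h y).2

variable {X : Type u} [TopologicalSpace X]

lemma zpow_add_apply (σ : X ≃ₜ X) (m n : ℤ) (x : X) :
    (σ ^ (m + n) : X ≃ₜ X) x = (σ ^ m : X ≃ₜ X) ((σ ^ n : X ≃ₜ X) x) := by
  rw [zpow_add]
  rfl

variable [CompactSpace X]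

lemma mem_periodicPts_of_zpow_eq {σ : X ≃ₜ X} {x : X} {k : ℤ} (hk : k ≠ 0)
    (h : (σ ^ k : X ≃ₜ X) x = x) : x ∈ Function.periodicPts σ := by
  have key : ∀ m : ℕ, m ≠ 0 → (σ ^ (m : ℤ) : X ≃ₜ X) x = x → x ∈ Function.periodicPts σ :=
    fun m hm h => ⟨m, Nat.pos_of_ne_zero hm, by rwa [zpow_natCast_apply] at h⟩
  obtain ⟨m, rfl | rfl⟩ := k.eq_nat_or_neg
  · exact key m (by simpa using hk) h
  · refine key m (by simpa using hk) ?_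
    -- Applying σᵐ to σ⁻ᵐx = x gives x = σᵐx.
    have h2 := zpow_add_apply σ m (-m) x
    rw [h, add_neg_cancel] at h2
    exact h2.symm

/-! ### Irreducibility of `π_x¹` -/

section Infinite

variable (σ : X ≃ₜ X)

/-- The embedding `ζ ↦ ∑ₙ ζₙ δⁿ` of `ℓ¹(ℤ)` into `ℓ¹(Σ)`. -/
def ofL1Z : l1Z →L[ℂ] L1 σ :=
  have hle : ∀ c : ℂ, ‖algebraMap ℂ C(X, ℂ) c‖ ≤ ‖c‖ := fun c =>
    (ContinuousMap.norm_le _ (norm_nonneg _)).2 fun _ => le_of_eq (by simp)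
  have hs : ∀ ζ : l1Z, Summable fun k => ‖algebraMap ℂ C(X, ℂ) (ζ k)‖ := fun ζ =>
    Summable.of_nonneg_of_le (fun _ => norm_nonneg _) (fun _ => hle _) (l1Z_summable ζ)
  LinearMap.mkContinuous
    { toFun := fun ζ => ⟨fun k => algebraMap ℂ C(X, ℂ) (ζ k),
        memℓp_gen (by simpa only [ENNReal.toReal_one, Real.rpow_one] using hs ζ)⟩
      map_add' := fun ζ η => L1.ext fun k => map_add (algebraMap ℂ C(X, ℂ)) (ζ k) (η k)
      map_smul' := fun z ζ => L1.ext fun k => by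
        change algebraMap ℂ C(X, ℂ) (z * ζ k) = z • algebraMap ℂ C(X, ℂ) (ζ k)
        rw [map_mul, Algebra.smul_def] }
    1 fun ζ => by
      rw [one_mul, l1Z_norm, L1.norm_eq]
      exact (hs ζ).tsum_le_tsum (fun _ => hle _) (l1Z_summable ζ)

lemma ofL1Z_apply (ζ : l1Z) (k : ℤ) (x : X) : ofL1Z σ ζ k x = ζ k := rfl

lemma norm_ofL1Z_le (ζ : l1Z) : ‖ofL1Z σ ζ‖ ≤ ‖ζ‖ := by
  have h : ‖ofL1Z σ‖ ≤ 1 := by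
    unfold ofL1Z
    exact LinearMap.mkContinuous_norm_le _ zero_le_one _
  simpa using (ofL1Z σ).le_of_opNorm_le h ζ

/-- The coefficients of `ofL1Z σ ζ` are constant functions, so their values along the orbit do not
matter. This is the exact solution at e₀ that is perturbed below. -/
lemma piInfinite_ofL1Z_single (x : X) (ζ : l1Z) :
    piInfinite σ x (ofL1Z σ ζ) (lp.single 1 0 (1 : ℂ)) = ζ := by
  refine lp.ext (funext fun k => ?_)
  rw [piInfinite_single_apply, ofL1Z_apply, sub_zero]

lemma norm_piInfinite_le (x : X) (a : L1 σ) : ‖piInfinite σ x a‖ ≤ ‖a‖ := by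
  have := (infinitePair σ x).integratedCLM.le_of_opNorm_le
    (LinearMap.mkContinuous_norm_le _ zero_le_one _) a
  rwa [one_mul] at this

lemma piInfinite_single (x : X) (m : ℤ) (f : C(X, ℂ)) (ξ : l1Z) (k : ℤ) :
    piInfinite σ x (L1.single m f) ξ k = f ((σ ^ k : X ≃ₜ X) x) * ξ (k - m) := by
  have h : piInfinite σ x (L1.single m f) = mulOp σ x f * shiftOp m := by
    rw [← shiftUnit_zpow]
    exact (infinitePair σ x).integratedCLM_single m f
  rw [h]
  rfl

/-- Vectors close to `e₀` are cyclic: `ζ ↦ π(∑ₙ ζₙ δⁿ)v` is a perturbation of the identity. -/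
lemma exists_piInfinite_eq_of_norm_lt (x : X) {v : l1Z}
    (hv : ‖lp.single 1 0 (1 : ℂ) - v‖ < 1) (η : l1Z) : ∃ a, piInfinite σ x a v = η := by
  let L : l1Z →L[ℂ] l1Z := (ContinuousLinearMap.apply ℂ l1Z v).comp
    ((infinitePair σ x).integratedCLM.comp (ofL1Z σ))
  have hL : ∀ ζ, L ζ = piInfinite σ x (ofL1Z σ ζ) v := fun ζ => rfl
  have h1 : ‖1 - L‖ < 1 := by
    refine lt_of_le_of_lt (ContinuousLinearMap.opNorm_le_bound _ (norm_nonneg _) fun ζ => ?_) hv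
    -- Here ζ is rewritten as π(∑ζₙδⁿ)e₀, so that 1 - L measures only the distance from e₀ to v.
    have : (1 - L) ζ = piInfinite σ x (ofL1Z σ ζ) (lp.single 1 0 (1 : ℂ) - v) := by
      rw [map_sub, piInfinite_ofL1Z_single, ← hL]
      rfl
    rw [this, mul_comm]
    exact (ContinuousLinearMap.le_opNorm _ _).trans (mul_le_mul_of_nonneg_right
      ((norm_piInfinite_le σ x _).trans (norm_ofL1Z_le σ ζ)) (norm_nonneg _))
  obtain ⟨U, hU⟩ := isUnit_one_sub_of_norm_lt_one h1
  rw [sub_sub_cancel] at hU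
  refine ⟨ofL1Z σ ((U⁻¹ : (l1Z →L[ℂ] l1Z)ˣ).val η), ?_⟩
  rw [← hL, ← hU, ← mul_apply_eq_comp, Units.mul_inv]
  rfl

/-- Take b = ξⱼ⁻¹ f δ⁻ʲ: the shift and the scalar put a 1 in position 0, and f removes all other
coordinates in a finite set that carries all but less than 1 of the norm. Aperiodicity is what
allows f to be 1 at x and 0 at the finitely many σᵏx with k ≠ 0. -/
lemma exists_piInfinite_norm_lt [T2Space X] {x : X} (hx : x ∉ Function.periodicPts σ) {ξ : l1Z}
    (hξ : ξ ≠ 0) : ∃ b, ‖lp.single 1 0 (1 : ℂ) - piInfinite σ x b ξ‖ < 1 := by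
  obtain ⟨j, hj⟩ : ∃ j, ξ j ≠ 0 := by
    by_contra! h
    exact hξ (lp.ext (funext h))
  -- The vector ξ shifted by -j and normalised, before the cut-off by f.
  let w : ℤ → ℂ := fun k => (ξ j)⁻¹ * ξ (k - -j)
  have hw0 : w 0 = 1 := by simp [w, hj]
  have hw : Summable fun k => ‖w k‖ := by
    simp only [w, norm_mul]
    exact ((Equiv.subRight (-j)).summable_iff.2 (l1Z_summable ξ)).mul_left _
  -- A finite set outside of which the ℓ¹-mass of w is less than 1.
  obtain ⟨s, hs⟩ := ((tendsto_tsum_compl_atTop_zero fun k => ‖w k‖).eventually_lt_const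
    one_pos).exists
  obtain ⟨f, hf1, hf0, hf⟩ := exists_continuousMap_eq_one_zero (x := x)
    (F := (fun k : ℤ => (σ ^ k : X ≃ₜ X) x) '' (s.erase 0 : Finset ℤ))
    ((s.erase 0).finite_toSet.image _) (by
      rintro ⟨k, hk, h⟩
      exact hx (mem_periodicPts_of_zpow_eq (Finset.ne_of_mem_erase hk) h))
  refine ⟨L1.single (-j) ((ξ j)⁻¹ • f), lt_of_le_of_lt ?_ hs⟩
  have hsub : (∑' a : { a // a ∉ s }, ‖w a‖)
      = ∑' k, Set.indicator {k | k ∉ s} (fun k => ‖w k‖) k :=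
    tsum_subtype {k | k ∉ s} fun k => ‖w k‖
  rw [l1Z_norm, hsub]
  refine (l1Z_summable _).tsum_le_tsum (fun k => ?_) (hw.indicator _)
  have hval : (lp.single 1 0 (1 : ℂ) - piInfinite σ x (L1.single (-j) ((ξ j)⁻¹ • f)) ξ : l1Z) k
      = (if k = 0 then 1 else 0) - f ((σ ^ k : X ≃ₜ X) x) * w k := by
    rw [lp.coeFn_sub, Pi.sub_apply, piInfinite_single, lp.single_apply, Pi.single_apply]
    congr 1
    change ((ξ j)⁻¹ * f ((σ ^ k : X ≃ₜ X) x)) * ξ (k - -j) = _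
    simp only [w]
    ring
  rw [hval]
  -- The difference vanishes at 0, where f and w are both 1, and on the rest of s, where f is 0;
  -- elsewhere |f| ≤ 1 leaves at most the tail of w.
  by_cases hk : k = 0
  · subst hk
    have : f ((σ ^ (0 : ℤ) : X ≃ₜ X) x) = 1 := hf1
    rw [this, hw0, if_pos rfl, mul_one, sub_self, norm_zero]
    exact Set.indicator_nonneg (fun _ _ => norm_nonneg _) _
  · rw [if_neg hk, zero_sub, norm_neg, norm_mul]
    by_cases hks : k ∈ s
    · rw [hf0 _ ⟨k, Finset.mem_coe.2 (Finset.mem_erase.2 ⟨hk, hks⟩), rfl⟩, norm_zero, zero_mul]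
      exact Set.indicator_nonneg (fun _ _ => norm_nonneg _) _
    · rw [Set.indicator_of_mem (by exact hks)]
      exact mul_le_of_le_one_left (norm_nonneg _) (hf _)

lemma exists_piInfinite_eq [T2Space X] {x : X} (hx : x ∉ Function.periodicPts σ) {ξ : l1Z}
    (hξ : ξ ≠ 0) (η : l1Z) : ∃ a, piInfinite σ x a ξ = η := by
  obtain ⟨b, hb⟩ := exists_piInfinite_norm_lt σ hx hξ
  obtain ⟨a, ha⟩ := exists_piInfinite_eq_of_norm_lt σ x hb η
  exact ⟨a * b, by rw [map_mul, mul_apply_eq_comp, ha]⟩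

instance : Nontrivial l1Z :=
  ⟨lp.single 1 0 (1 : ℂ), 0, fun h => by
    have := congrArg (fun ξ : l1Z => ξ 0) h
    simp at this⟩

end Infinite

/-! ### Irreducibility of `π_{x,λ}` -/

section Finite

variable {σ : X ≃ₜ X} {p : ℕ} [NeZero p] {x : X}

/-- The vectors `T_λᵏ e₀`, `k ∈ ℤ`: explicitly, `T_λᵏ e₀ = λᵐ e_i` if `k = pm + i` with
`0 ≤ i < p`. -/
def shiftOrbit (p : ℕ) (l : Circle) (k : ℤ) : EuclideanSpace ℂ (Fin p) :=
  WithLp.toLp 2 fun i =>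
    if (p : ℤ) ∣ k - (i : ℕ) then ((l ^ ((k - (i : ℕ)) / p) : Circle) : ℂ) else 0

lemma shiftOrbit_apply (p : ℕ) (l : Circle) (k : ℤ) (i : Fin p) : shiftOrbit p l k i =
    if (p : ℤ) ∣ k - (i : ℕ) then ((l ^ ((k - (i : ℕ)) / p) : Circle) : ℂ) else 0 := rfl

lemma shiftOrbit_natCast (l : Circle) (j : Fin p) :
    shiftOrbit p l (j : ℕ) = EuclideanSpace.single j 1 := by
  ext i
  rw [shiftOrbit_apply, PiLp.single_apply]
  by_cases h : i = j
  · simp [h]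
  · rw [if_neg h, if_neg]
    intro hd
    refine h (Fin.ext ?_)
    have hi := i.isLt
    have hj := j.isLt
    have := Int.eq_zero_of_abs_lt_dvd hd (by rw [abs_lt]; omega)
    omega

lemma coe_finitePair_T_apply (hx : Function.IsPeriodicPt σ p x) (l : Circle)
    (v : EuclideanSpace ℂ (Fin p)) (i : Fin p) :
    ((finitePair σ p x hx l).T : EuclideanSpace ℂ (Fin p) →L[ℂ] EuclideanSpace ℂ (Fin p)) v i
      = (if i = 0 then (l : ℂ) else 1) * v (i - 1) := by
  change ∑ j, shiftMatrix p l i j * v j = _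
  rw [Finset.sum_eq_single (i - 1)]
  · simp [shiftMatrix]
  · intro j _ hj
    have : j + 1 ≠ i := fun h => hj (eq_sub_of_add_eq h)
    simp [shiftMatrix, this]
  · simp

lemma finitePair_rho_apply (hx : Function.IsPeriodicPt σ p x) (l : Circle) (f : C(X, ℂ))
    (v : EuclideanSpace ℂ (Fin p)) (i : Fin p) :
    (finitePair σ p x hx l).rho f v i = f (σ^[i] x) * v i := by
  change (Matrix.diagonal (fun i : Fin p => f (σ^[i] x))).mulVec v.ofLp i = _
  rw [Matrix.mulVec_diagonal]

/-- Only i = 0 needs care: its cyclic predecessor is p - 1, and k - (p - 1) = (k + 1) - p, so the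
exponent of λ there is one too small, which the corner entry λ of the matrix makes up for. -/
lemma finitePair_T_shiftOrbit (hx : Function.IsPeriodicPt σ p x) (l : Circle) (k : ℤ) :
    ((finitePair σ p x hx l).T : EuclideanSpace ℂ (Fin p) →L[ℂ] EuclideanSpace ℂ (Fin p))
      (shiftOrbit p l k) = shiftOrbit p l (k + 1) := by
  ext i
  rw [coe_finitePair_T_apply, shiftOrbit_apply, shiftOrbit_apply]
  have hp : (p : ℤ) ≠ 0 := Int.natCast_ne_zero.2 (NeZero.ne p)
  by_cases hi : i = 0
  · subst hi
    have h1 : (((0 - 1 : Fin p) : ℕ) : ℤ) = p - 1 := by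
      have hp' := NeZero.pos p
      obtain ⟨q, rfl⟩ : ∃ q, p = q + 1 := ⟨p - 1, by omega⟩
      simp
    have h2 : k - ((p : ℤ) - 1) = k + 1 + p * (-1) := by ring
    have h3 : (p : ℤ) ∣ k + 1 + p * (-1) ↔ (p : ℤ) ∣ k + 1 :=
      (Int.dvd_add_left (Dvd.intro _ rfl))
    rw [h1, h2, if_pos rfl, Int.add_mul_ediv_left _ _ hp]
    simp only [h3, Fin.val_zero, Nat.cast_zero, sub_zero]
    split_ifs
    · rw [← Circle.coe_mul, ← zpow_one_add]
      congr 2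
      ring
    · rw [mul_zero]
  · have h1 : (((i - 1 : Fin p) : ℕ) : ℤ) = (i : ℕ) - 1 := by
      rw [Fin.val_sub_one_of_ne_zero hi]
      have : (i : ℕ) ≠ 0 := fun h => hi (Fin.ext h)
      omega
    rw [h1, if_neg hi, one_mul, show k - ((i : ℕ) - 1 : ℤ) = k + 1 - (i : ℕ) by ring]

/-- Indexing the vectors T_λᵏe₀ by all of ℤ turns powers of T_λ, negative ones included, into
addition of indices, so no matrix power is ever computed. -/
lemma finitePair_T_zpow_shiftOrbit (hx : Function.IsPeriodicPt σ p x) (l : Circle) (n k : ℤ) :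
    (((finitePair σ p x hx l).T ^ n : (EuclideanSpace ℂ (Fin p) →L[ℂ]
      EuclideanSpace ℂ (Fin p))ˣ) : EuclideanSpace ℂ (Fin p) →L[ℂ] EuclideanSpace ℂ (Fin p))
      (shiftOrbit p l k) = shiftOrbit p l (n + k) := by
  induction n generalizing k with
  | zero => simp
  | succ n ih =>
    rw [zpow_add, zpow_one, Units.val_mul, mul_apply_eq_comp,
      finitePair_T_shiftOrbit, ih]
    congr 1
    ring
  | pred n ih =>
    have h : ((finitePair σ p x hx l).T⁻¹ : (EuclideanSpace ℂ (Fin p) →L[ℂ]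
        EuclideanSpace ℂ (Fin p))ˣ).val (shiftOrbit p l k) = shiftOrbit p l (k - 1) := by
      conv_lhs => rw [← sub_add_cancel k 1, ← finitePair_T_shiftOrbit hx,
        ← mul_apply_eq_comp, Units.inv_mul]
      rfl
    rw [sub_eq_add_neg, zpow_add, zpow_neg_one, Units.val_mul, mul_apply_eq_comp, h,
      ih]
    congr 1
    ring

/-- Injectivity of the orbit map lets a Urysohn function isolate one nonzero coordinate ξᵢ; after
division by ξᵢ this gives eᵢ, and δʲ⁻ⁱ carries eᵢ to eⱼ. -/
lemma exists_integrated_finitePair_eq [T2Space X] (hx : Function.IsPeriodicPt σ p x)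
    (hinj : Function.Injective fun i : Fin p => σ^[i] x) (l : Circle)
    {ξ : EuclideanSpace ℂ (Fin p)} (hξ : ξ ≠ 0) (η : EuclideanSpace ℂ (Fin p)) :
    ∃ a, (finitePair σ p x hx l).integrated a ξ = η := by
  obtain ⟨i, hi⟩ : ∃ i, ξ i ≠ 0 := by
    by_contra! h
    exact hξ (PiLp.ext h)
  obtain ⟨f, hf1, hf0, -⟩ := exists_continuousMap_eq_one_zero (x := σ^[i] x)
    (F := (fun j : Fin p => σ^[j] x) '' {j | j ≠ i}) (Set.toFinite _) (by
      rintro ⟨j, hj, h⟩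
      exact hj (hinj h))
  have hsingle : ∀ n g, (finitePair σ p x hx l).integrated (L1.single n g)
      = (finitePair σ p x hx l).rho g * ((finitePair σ p x hx l).T ^ n).val :=
    (finitePair σ p x hx l).integratedCLM_single
  have h1 : (finitePair σ p x hx l).integrated (L1.single 0 ((ξ i)⁻¹ • f)) ξ
      = shiftOrbit p l (i : ℕ) := by
    rw [hsingle, zpow_zero, Units.val_one, mul_one, shiftOrbit_natCast]
    ext j
    rw [finitePair_rho_apply, PiLp.single_apply]
    change ((ξ i)⁻¹ * f (σ^[j] x)) * ξ j = _
    by_cases h : j = i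
    · subst h
      rw [hf1, mul_one, inv_mul_cancel₀ hi, if_pos rfl]
    · rw [hf0 _ ⟨j, h, rfl⟩, if_neg h, mul_zero, zero_mul]
  have h2 : ∀ j : Fin p, (finitePair σ p x hx l).integrated (L1.single ((j : ℕ) - (i : ℕ)) 1)
      (shiftOrbit p l (i : ℕ)) = EuclideanSpace.single j 1 := by
    intro j
    rw [hsingle, map_one, one_mul, finitePair_T_zpow_shiftOrbit, sub_add_cancel,
      shiftOrbit_natCast]
  -- The right factor sends ξ to eᵢ, the left factor sends eᵢ to ∑ ηⱼeⱼ.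
  refine ⟨(∑ j, η j • L1.single ((j : ℕ) - (i : ℕ)) 1) * L1.single 0 ((ξ i)⁻¹ • f), ?_⟩
  rw [map_mul, mul_apply_eq_comp, h1, map_sum, sum_apply]
  ext k
  simp [h2, Pi.single_apply]

lemma exists_piFinite_eq [T2Space X] (hx : x ∈ Function.periodicPts σ) (l : Circle)
    {ξ : EuclideanSpace ℂ (Fin (Function.minimalPeriod σ x))} (hξ : ξ ≠ 0)
    (η : EuclideanSpace ℂ (Fin (Function.minimalPeriod σ x))) :
    ∃ a, piFinite σ x hx l a ξ = η := by
  have : NeZero (Function.minimalPeriod σ x) :=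
    ⟨(Function.minimalPeriod_pos_of_mem_periodicPts hx).ne'⟩
  refine exists_integrated_finitePair_eq (Function.isPeriodicPt_minimalPeriod σ x)
    (fun i j h => Fin.ext ?_) l hξ η
  exact Function.iterate_injOn_Iio_minimalPeriod i.isLt j.isLt h

/-- The entry of `π_{x,λ}(a)` that picks out the coefficients `a(n)(x)` with `p ∣ n + k`. -/
lemma hasSum_integrated_finitePair_zero (hx : Function.IsPeriodicPt σ p x) (l : Circle)
    (a : L1 σ) (k : ℤ) :
    HasSum (fun n : ℤ => a n x *
        if (p : ℤ) ∣ n + k then ((l ^ ((n + k) / p) : Circle) : ℂ) else 0)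
      ((finitePair σ p x hx l).integrated a (shiftOrbit p l k) 0) := by
  have h : HasSum (fun n : ℤ => (finitePair σ p x hx l).rho (a n) *
      ((finitePair σ p x hx l).T ^ n).val) ((finitePair σ p x hx l).integrated a) :=
    ((finitePair σ p x hx l).summable_term a).hasSum
  have h2 := (h.mapL (ContinuousLinearMap.apply ℂ (EuclideanSpace ℂ (Fin p))
    (shiftOrbit p l k))).mapL (EuclideanSpace.proj (𝕜 := ℂ) (0 : Fin p))
  have h3 : ∀ n, EuclideanSpace.proj (𝕜 := ℂ) (0 : Fin p)
      (ContinuousLinearMap.apply ℂ (EuclideanSpace ℂ (Fin p)) (shiftOrbit p l k)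
        ((finitePair σ p x hx l).rho (a n) * ((finitePair σ p x hx l).T ^ n).val))
      = a n x * if (p : ℤ) ∣ n + k then ((l ^ ((n + k) / p) : Circle) : ℂ) else 0 := by
    intro n
    change (finitePair σ p x hx l).rho (a n)
      (((finitePair σ p x hx l).T ^ n).val (shiftOrbit p l k)) 0 = _
    rw [finitePair_T_zpow_shiftOrbit, finitePair_rho_apply, shiftOrbit_apply]
    simp
  simp only [h3] at h2
  exact h2

end Finite

/-! ### Uniqueness of absolutely convergent Fourier series -/

/-- Absolute summability makes the series converge uniformly, so its sum is the zero function not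
just pointwise but in C(𝕋), hence in L². Pairing with the m-th character then isolates `c m`. -/
lemma eq_zero_of_hasSum_circle_zpow {c : ℤ → ℂ} (hc : Summable fun n => ‖c n‖)
    (h : ∀ μ : Circle, HasSum (fun n : ℤ => c n * ((μ ^ n : Circle) : ℂ)) 0) : c = 0 := by
  have : Fact (0 < (1 : ℝ)) := ⟨one_pos⟩
  have hs : Summable fun n => c n • fourier (T := 1) n :=
    Summable.of_norm (by simpa only [norm_smul, fourier_norm, mul_one] using hc)
  have h0 : HasSum (fun n => c n • fourier (T := 1) n) 0 := by
    have hsum : ∑' n, c n • fourier (T := 1) n = 0 := by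
      ext t
      have h1 := hs.hasSum.mapL (ContinuousMap.evalCLM ℂ t)
      have h2 : ∀ n, ContinuousMap.evalCLM ℂ t (c n • fourier (T := 1) n)
          = c n * ((AddCircle.toCircle t ^ n : Circle) : ℂ) := by
        intro n
        rw [← AddCircle.toCircle_zsmul]
        rfl
      simp only [h2] at h1
      exact h1.unique (h (AddCircle.toCircle t))
    exact hsum ▸ hs.hasSum
  -- Continuous linear maps preserve sums, so the passage to L² and the inner product are taken term
  -- by term.
  have h2 := h0.mapL (ContinuousMap.toLp 2 (AddCircle.haarAddCircle (T := 1)) ℂ)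
  rw [map_zero] at h2
  funext m
  have h3 := h2.mapL (innerSL ℂ (fourierLp (T := 1) 2 m))
  have h4 : ∀ n, innerSL ℂ (fourierLp (T := 1) 2 m)
      (ContinuousMap.toLp 2 AddCircle.haarAddCircle ℂ (c n • fourier (T := 1) n))
      = if n = m then c n else 0 := by
    intro n
    rw [map_smul, map_smul, innerSL_apply_apply]
    change c n • inner ℂ (fourierLp (T := 1) 2 m) (fourierLp (T := 1) 2 n) = _
    rw [orthonormal_iff_ite.1 orthonormal_fourier]
    by_cases h : n = m
    · simp [h]
    · simp [h, Ne.symm h]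
  simp only [h4, map_zero] at h3
  have h5 := hasSum_single (f := fun n => if n = m then c n else 0) m fun n hn => if_neg hn
  rw [if_pos rfl] at h5
  exact h5.unique h3

/-! ### Vanishing of coefficients -/

/-- The 0-th coordinate of π_{x,λ}(a)T_λ⁻ⁿe₀ is the sum of a(m + n)(x) λ^(m/p) over the multiples m
of p. As λ varies this is a Fourier series whose constant term is a(n)(x). -/
lemma apply_eq_zero_of_piFinite_eq_zero {σ : X ≃ₜ X} {x : X} (hx : x ∈ Function.periodicPts σ)
    {a : L1 σ} (h : ∀ l, piFinite σ x hx l a = 0) (n : ℤ) : a n x = 0 := by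
  have : NeZero (Function.minimalPeriod σ x) :=
    ⟨(Function.minimalPeriod_pos_of_mem_periodicPts hx).ne'⟩
  set p := Function.minimalPeriod σ x with hp
  have hper : Function.IsPeriodicPt σ p x := Function.isPeriodicPt_minimalPeriod σ x
  have hz : ∀ l, (finitePair σ p x hper l).integrated a = 0 := h
  let c : ℤ → ℂ := fun m => if (p : ℤ) ∣ m then a (m + n) x else 0
  have hc : Summable fun m => ‖c m‖ := by
    refine Summable.of_nonneg_of_le (fun _ => norm_nonneg _) (fun m => ?_)
      ((Equiv.addRight n).summable_iff.2 a.summable_norm)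
    simp only [c]
    split_ifs
    · exact (a (m + n)).norm_coe_le_norm x
    · simp
  have h0 : c = 0 := by
    refine eq_zero_of_hasSum_circle_zpow hc fun μ => ?_
    -- With λ = μᵖ, the factor λ^(m/p) becomes μᵐ, so the series is indexed by all of ℤ, with
    -- coefficients `c` supported on the multiples of p.
    have h1 := hasSum_integrated_finitePair_zero hper (μ ^ p) a (-n)
    rw [hz] at h1
    refine Eq.mp (congrArg (HasSum · 0) (funext fun m => ?_))
      ((Equiv.addRight n).hasSum_iff.2 h1)
    change a (m + n) x * (if (p : ℤ) ∣ m + n + -n then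
      (((μ ^ p) ^ ((m + n + -n) / (p : ℤ)) : Circle) : ℂ) else 0) = c m * ((μ ^ m : Circle) : ℂ)
    rw [add_neg_cancel_right]
    by_cases hm : (p : ℤ) ∣ m
    · simp only [c, if_pos hm]
      rw [← zpow_natCast, ← zpow_mul, Int.mul_ediv_cancel' hm]
    · simp only [c, if_neg hm, mul_zero, zero_mul]
  -- The index 0 is a multiple of p, and `c 0` is a(n)(x).
  simpa [c] using congrFun h0 0

/-! ### Primitivity of the ideals and their intersection -/

lemma isPrimitiveIdeal_idealFinite [T2Space X] (σ : X ≃ₜ X) (C : periodicOrbitClosures σ)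
    (l : Circle) : IsPrimitiveIdeal (idealFinite σ C l) := by
  have hx := C.2.choose_spec.1
  -- A positive period makes ℂᵖ nontrivial, as `isPrimitiveIdeal_ker` requires.
  have : NeZero (Function.minimalPeriod σ C.2.choose) :=
    ⟨(Function.minimalPeriod_pos_of_mem_periodicPts hx).ne'⟩
  exact isPrimitiveIdeal_ker _ fun _ hξ η => exists_piFinite_eq hx l hξ η

lemma isPrimitiveIdeal_idealInfinite [T2Space X] (σ : X ≃ₜ X) (C : aperiodicOrbitClosures σ) :
    IsPrimitiveIdeal (idealInfinite σ C) :=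
  isPrimitiveIdeal_ker _ fun _ hξ η => exists_piInfinite_eq σ C.2.choose_spec.1 hξ η

/-- Every point is periodic or aperiodic and lies in its own orbit closure, so the ideals attached
to that closure already force all coefficients to vanish there. -/
lemma iInf_idealFinite_inf_iInf_idealInfinite [T2Space X] (σ : X ≃ₜ X) :
    (⨅ (C : periodicOrbitClosures σ) (l : Circle), idealFinite σ C l) ⊓
      (⨅ C : aperiodicOrbitClosures σ, idealInfinite σ C) = ⊥ := by
  refine eq_bot_iff.2 fun a ha => ?_
  simp only [TwoSidedIdeal.mem_inf, TwoSidedIdeal.mem_iInf] at ha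
  rw [TwoSidedIdeal.mem_bot]
  ext n x
  by_cases hx : x ∈ Function.periodicPts σ
  · refine apply_eq_zero_of_piFinite_eq_zero hx (fun l => ?_) n
    have := ha.1 ⟨closure (orbit σ x), x, hx, rfl⟩ l
    rwa [idealFinite_eq, TwoSidedIdeal.mem_ker] at this
  · have := ha.2 ⟨closure (orbit σ x), x, hx, rfl⟩
    rw [idealInfinite_eq σ x hx, TwoSidedIdeal.mem_ker, piInfinite_eq_zero_iff] at this
    exact this n x (mem_closure_orbit σ x)

end DynSys

end

theorem mainTheorem4 {X : Type*} [TopologicalSpace X] [CompactSpace X] [T2Space X] [Nonempty X]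
    (σ : X ≃ₜ X) :
    (∀ (C : DynSys.periodicOrbitClosures σ) (z : Circle),
      DynSys.IsPrimitiveIdeal (DynSys.idealFinite σ C z)) ∧
    (∀ C : DynSys.aperiodicOrbitClosures σ,
      DynSys.IsPrimitiveIdeal (DynSys.idealInfinite σ C)) ∧
    ((⨅ (C : DynSys.periodicOrbitClosures σ) (z : Circle), DynSys.idealFinite σ C z) ⊓
      (⨅ C : DynSys.aperiodicOrbitClosures σ, DynSys.idealInfinite σ C) = ⊥) ∧
    DynSys.IsSemisimpleAlgebra (DynSys.L1 σ) := by
  refine ⟨DynSys.isPrimitiveIdeal_idealFinite σ, DynSys.isPrimitiveIdeal_idealInfinite σ,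
    DynSys.iInf_idealFinite_inf_iInf_idealInfinite σ, ?_⟩
  -- The radical is an infimum over a family that contains all these ideals, so it lies below their
  -- zero intersection.
  refine eq_bot_iff.2 (le_trans ?_ (DynSys.iInf_idealFinite_inf_iInf_idealInfinite σ).le)
  exact le_inf
    (le_iInf fun C => le_iInf fun z => sInf_le (DynSys.isPrimitiveIdeal_idealFinite σ C z))
    (le_iInf fun C => sInf_le (DynSys.isPrimitiveIdeal_idealInfinite σ C))
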